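/- Let $n\ge 1$. In the insertion-only model a stream is a finite sequence $a_1,\dots,a_m$ of items of $[n]=\{1,\dots,n\}$, and its frequency vector $x\in\mathbb{Z}_{\ge 0}^n$ has as entry $x_i$ the number of occurrences of $i$. In the $\varepsilon$-$\ell_p$-heavy hitters problem one must output a set $T\subseteq[n]$ that contains every $i$ with $x_i^p\ge\varepsilon^p\|x\|_p^p$ and contains no $i$ with $x_i^p\le\frac{\varepsilon^p}{2}\|x\|_p^p$. A deterministic $r$-pass streaming algorithm with $S$ bits of space reads the stream $r$ times in order and retains between items only a memory content in $\{0,1\}^S$. The new content is a function of the number of the pass, the old content and the current item. At the start of each pass the content may be changed by a function of the number of the pass and the content. The output is a function of the final memory content. There are absolute constants $c>0$ and $K\in\mathbb{N}$ such that the following holds for all integers $n,r\ge 1$, all real $p\ge 1$ and all $\varepsilon\in(n^{-1/p},\tfrac12)$. Every deterministic $r$-pass streaming algorithm that solves the $\varepsilon$-$\ell_p$-heavy hitters problem on all non-empty insertion-only streams over $[n]$ of length at most $Kn$ uses $$S\ \ge\ c\cdot\frac{n^{1-1/p}}{r\,\varepsilon}$$ bits of space. In particular, for $p=2$ and a bounded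 number of passes this is $\Omega(\sqrt n/\varepsilon)$: for every $R$ there is $c_R>0$ such that for all $n\ge1$, all $\varepsilon\in(n^{-1/2},\frac12)$ and all $1\le r\le R$, every such algorithm (with $p=2$) uses $S\ge c_R\sqrt n/\varepsilon$ bits. -/

import Mathlib

open scoped BigOperators

/-- A deterministic multi-pass streaming algorithm over the universe `Fin n` which uses `S` bits of
memory: between two items it retains nothing but an element of `Fin S → Bool`. The algorithm is
non-uniform, knows which pass it is in, and may reorganise its memory at the start of each pass;
only the retained memory is charged for. The answer is a function of the final memory content. -/
structure StreamAlg (n S : ℕ) where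
  /-- The memory content before the first pass. -/
  init : Fin S → Bool
  /-- What is done to the memory at the start of pass `j` (passes are numbered from `0`). -/
  startPass : ℕ → (Fin S → Bool) → (Fin S → Bool)
  /-- How an item that arrives during pass `j` changes the memory. -/
  step : ℕ → (Fin S → Bool) → Fin n → (Fin S → Bool)
  /-- The answer, read off from the final memory. -/
  output : (Fin S → Bool) → Finset (Fin n)

/-- The memory content of the algorithm after `j` passes over the stream `w`. -/
def StreamAlg.memory {n S : ℕ} (A : StreamAlg n S) (w : List (Fin n)) : ℕ → (Fin S → Bool)
  | 0 => A.init
  | j + 1 => w.foldl (A.step j) (A.startPass j (A.memory w j))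

/-- The frequency vector of an insertion-only stream: `x i` is the number of occurrences of `i`,
that is, `x` is the result of the updates `x ← x + e_i` started at `0`. -/
def streamFreq {n : ℕ} (w : List (Fin n)) : Fin n → ℕ := fun i => w.count i

/-- `T` is a correct answer to the `ε`-`ℓ_p`-heavy hitters problem for the frequency vector `x`:
it contains every `i` with `x_i ^ p ≥ ε ^ p * ‖x‖_p ^ p` and no `i` with
`x_i ^ p ≤ (ε ^ p / 2) * ‖x‖_p ^ p`. -/
def IsHeavyHitterSet {n : ℕ} (p ε : ℝ) (x : Fin n → ℕ) (T : Finset (Fin n)) : Prop :=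
  ∀ i : Fin n,
    (ε ^ p * ∑ j, (x j : ℝ) ^ p ≤ (x i : ℝ) ^ p → i ∈ T) ∧
    ((x i : ℝ) ^ p ≤ ε ^ p / 2 * ∑ j, (x j : ℝ) ^ p → i ∉ T)

/-- With `r` passes, `A` solves `ε`-`ℓ_p`-heavy hitters on all insertion-only streams of length at
most `L`. (For the empty stream both conditions apply to every `i`, so there is no correct
answer, and it is left out.) -/
def StreamAlg.SolvesHeavyHitters {n S : ℕ} (A : StreamAlg n S) (r : ℕ) (p ε : ℝ) (L : ℕ) : Prop :=
  ∀ w : List (Fin n), w ≠ [] → w.length ≤ L →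
    IsHeavyHitterSet p ε (streamFreq w) (A.output (A.memory w r))

/-! Give each item of the first half of the universe a random owner among `k ≈ 16 ε n^(1/p)` blocks
and a random bit; block `j` lists its items with bit set, after four copies of each remaining item.
The memory after every block in every pass is a transcript of `S * k * r` bits. In such a stream
item `i` occurs at most once, so it is light. If more than half of the owners were compatible with
one transcript, splicing their blocks (`memory_diagonal`) would keep the answer but make `i` heavy.
So at most half are compatible (`card_compatibleOwners_le`). When the bit of `i` is unset, the
transcript does not depend on the owner of `i`, so that owner is incompatible with probability at
least 1/2, and the transcript then certifies that the bit is unset. On average at least a quarter of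
the bits are certified, while certifying `u` bits confines `b` to a `2^(-u)` fraction of the cube.
By Jensen there are at least `2^(m/4)` transcripts for `m = n / 2` items
(`two_pow_card_le_card_transcripts_pow`). -/

/-! ### Counting transcripts -/

open Classical in
/-- The values of `D` at `i` which are compatible with the transcript of `(D, b)` and the bit at
`i` being set, everything else in `D` being kept. -/
noncomputable def compatibleOwners {ι κ τ : Type*} [DecidableEq ι] [Fintype κ]
    (ρ : (ι → κ) → (ι → Bool) → τ) (D : ι → κ) (b : ι → Bool) (i : ι) : Finset κ :=
  Finset.univ.filter fun j => ∃ b', b' i = true ∧ ρ (Function.update D i j) b' = ρ D b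

theorem mem_compatibleOwners {ι κ τ : Type*} [DecidableEq ι] [Fintype κ]
    {ρ : (ι → κ) → (ι → Bool) → τ} {D : ι → κ} {b : ι → Bool} {i : ι} {j : κ} :
    j ∈ compatibleOwners ρ D b i ↔
      ∃ b', b' i = true ∧ ρ (Function.update D i j) b' = ρ D b := by
  simp [compatibleOwners]

/-- Swapping `D i` with `j` is an involution on pairs; hence resampling one coordinate preserves the
uniform distribution. -/
theorem sum_sum_update {ι κ M : Type*} [Fintype ι] [DecidableEq ι] [Fintype κ]
    [AddCommMonoid M] (i : ι) (f : (ι → κ) → M) :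
    ∑ D : ι → κ, ∑ j : κ, f (Function.update D i j) = Fintype.card κ • ∑ D, f D := by
  have h : ∑ x : (ι → κ) × κ, f (Function.update x.1 i x.2) = ∑ x : (ι → κ) × κ, f x.1 := by
    refine Finset.sum_nbij' (fun x => (Function.update x.1 i x.2, x.1 i))
      (fun x => (Function.update x.1 i x.2, x.1 i)) ?_ ?_ ?_ ?_ ?_ <;> simp
  rw [Fintype.sum_prod_type, Fintype.sum_prod_type] at h
  simpa [Finset.sum_nsmul] using h

theorem card_bits_le_of_forall_false {ι : Type*} [Fintype ι] [DecidableEq ι] (U : Finset ι)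
    (s : Finset (ι → Bool)) (hs : ∀ b ∈ s, ∀ i ∈ U, b i = false) :
    s.card * 2 ^ U.card ≤ 2 ^ Fintype.card ι := by
  have h1 : s ⊆ Fintype.piFinset fun i => if i ∈ U then {false} else Finset.univ := by
    intro b hb
    rw [Fintype.mem_piFinset]
    intro i
    by_cases hi : i ∈ U
    · simp [hi, hs b hb i hi]
    · simp [hi]
  have h2 := Finset.card_le_card h1
  rw [Fintype.card_piFinset] at h2
  have h3 : ∏ i, (if i ∈ U then ({false} : Finset Bool) else Finset.univ).card
      = 2 ^ (Uᶜ).card := by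
    rw [← Finset.prod_const]
    rw [← Finset.prod_subset (Finset.subset_univ Uᶜ)]
    · refine Finset.prod_congr rfl fun i hi => ?_
      simp [Finset.mem_compl.1 hi]
    · intro i _ hi
      simp at hi
      simp [hi]
  rw [h3] at h2
  calc s.card * 2 ^ U.card ≤ 2 ^ (Uᶜ).card * 2 ^ U.card := Nat.mul_le_mul_right _ h2
    _ = 2 ^ Fintype.card ι := by rw [← pow_add, Finset.card_compl_add_card]

/-- If each transcript `ρ b` forces the bits in a set `U (ρ b)` to vanish, then the mean of
`2 ^ |U (ρ b)|` is at most the number of transcripts. -/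
theorem sum_two_pow_forced_le {ι τ : Type*} [Fintype ι] [DecidableEq ι] [Fintype τ]
    [DecidableEq τ] (ρ : (ι → Bool) → τ) (U : τ → Finset ι)
    (hU : ∀ b, ∀ i ∈ U (ρ b), b i = false) :
    ∑ b, 2 ^ (U (ρ b)).card ≤ Fintype.card τ * 2 ^ Fintype.card ι := by
  rw [← Finset.sum_fiberwise (s := Finset.univ) (g := ρ)]
  calc ∑ t, ∑ b with ρ b = t, 2 ^ (U (ρ b)).card
      ≤ ∑ _t : τ, 2 ^ Fintype.card ι := by
        refine Finset.sum_le_sum fun t _ => ?_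
        rw [Finset.sum_congr rfl (g := fun _ => 2 ^ (U t).card)]
        · rw [Finset.sum_const, smul_eq_mul]
          refine card_bits_le_of_forall_false _ _ fun b hb i hi => hU b i ?_
          rw [(Finset.mem_filter.1 hb).2]
          exact hi
        · intro b hb
          rw [(Finset.mem_filter.1 hb).2]
    _ = _ := by simp

/-- Jensen's inequality, by the tangent line of `2 ^ u` at `a`. -/
theorem two_rpow_mul_card_le_sum {α : Type*} (s : Finset α) (u : α → ℕ) (a : ℝ)
    (h : a * s.card ≤ ∑ x ∈ s, (u x : ℝ)) :
    (2 : ℝ) ^ a * s.card ≤ ∑ x ∈ s, (2 : ℝ) ^ u x := by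
  have key : ∀ x, (2 : ℝ) ^ a * (1 + ((u x : ℝ) - a) * Real.log 2) ≤ (2 : ℝ) ^ u x := by
    intro x
    have h1 : (2 : ℝ) ^ u x = 2 ^ a * 2 ^ ((u x : ℝ) - a) := by
      rw [← Real.rpow_add two_pos, add_sub_cancel, Real.rpow_natCast]
    rw [h1]
    refine mul_le_mul_of_nonneg_left ?_ (Real.rpow_nonneg two_pos.le _)
    rw [Real.rpow_def_of_pos two_pos, add_comm, mul_comm]
    exact Real.add_one_le_exp _
  refine le_trans ?_ (Finset.sum_le_sum fun x _ => key x)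
  rw [← Finset.mul_sum]
  refine mul_le_mul_of_nonneg_left ?_ (Real.rpow_nonneg two_pos.le _)
  rw [Finset.sum_add_distrib, ← Finset.sum_mul, Finset.sum_sub_distrib]
  simp only [Finset.sum_const, nsmul_eq_mul, mul_one]
  have := Real.log_pos (one_lt_two : (1 : ℝ) < 2)
  nlinarith [mul_nonneg (sub_nonneg.2 h) this.le]

open Classical in
/-- A transcript function which does not see the owner of an unset bit, and which, whatever the
transcript, leaves at most half of the owners possible for a set bit, takes many values. -/
theorem two_pow_card_le_card_transcripts_pow {ι κ τ : Type*} [Fintype ι] [DecidableEq ι]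
    [Fintype κ] [Nonempty κ] [Fintype τ] (ρ : (ι → κ) → (ι → Bool) → τ)
    (hρ : ∀ D b i j, b i = false → ρ (Function.update D i j) b = ρ D b)
    (hV : ∀ D b i, 2 * (compatibleOwners ρ D b i).card ≤ Fintype.card κ) :
    2 ^ Fintype.card ι ≤ Fintype.card τ ^ 4 := by
  set U : (ι → κ) → (ι → Bool) → Finset ι := fun D b =>
    Finset.univ.filter fun i => D i ∉ compatibleOwners ρ D b i with hUdef
  set N : ℕ := Fintype.card ((ι → κ) × (ι → Bool)) with hN
  have hNpos : 0 < N := Fintype.card_pos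
  have upper : ∑ x : (ι → κ) × (ι → Bool), 2 ^ (U x.1 x.2).card ≤ Fintype.card τ * N := by
    rw [Fintype.sum_prod_type]
    calc ∑ D, ∑ b, 2 ^ (U D b).card
        ≤ ∑ _D : ι → κ, Fintype.card τ * 2 ^ Fintype.card ι := by
          refine Finset.sum_le_sum fun D _ => ?_
          refine sum_two_pow_forced_le (ρ D) (fun t => Finset.univ.filter fun i =>
            ¬ ∃ b', b' i = true ∧ ρ D b' = t) ?_ |>.trans' (le_of_eq ?_)
          · intro b i hi
            simp only [Finset.mem_filter, Finset.mem_univ, true_and, not_exists, not_and] at hi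
            by_contra hb
            exact hi b (by simpa using hb) rfl
          · refine Finset.sum_congr rfl fun b _ => ?_
            simp [hUdef, compatibleOwners]
      _ = Fintype.card τ * N := by simp [hN]; ring
  -- The factor 4: the bit at `i` is unset half of the time, and then the owner is incompatible at
  -- least half of the time.
  have lower_one : ∀ i, N ≤ 4 * ((Finset.univ : Finset ((ι → κ) × (ι → Bool))).filter
      fun x => i ∈ U x.1 x.2).card := by
    intro i
    set F : (ι → Bool) → (ι → κ) → ℕ := fun b D => if i ∈ U D b then 1 else 0 with hF
    have hhalf : ∀ b : ι → Bool, b i = false →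
        Fintype.card (ι → κ) ≤ 2 * ∑ D, F b D := by
      intro b hb
      have h1 := sum_sum_update (κ := κ) i (F b)
      have h2 : ∀ D : ι → κ, Fintype.card κ ≤ 2 * ∑ j, F b (Function.update D i j) := by
        intro D
        -- As `b i` is unset, the compatible set is independent of the owner being resampled.
        have h3 : ∀ j, compatibleOwners ρ (Function.update D i j) b i
            = compatibleOwners ρ D b i := by
          intro j
          ext x
          simp [compatibleOwners, hρ D b i j hb]
        have h4 : ∑ j, F b (Function.update D i j) = (compatibleOwners ρ D b i)ᶜ.card := by
          simp only [hF, hUdef, Finset.mem_filter, Finset.mem_univ, true_and, h3,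
            Function.update_self]
          rw [← Finset.card_filter]
          congr 1
          ext j
          simp
        have h5 := hV D b i
        have h6 := Finset.card_compl_add_card (compatibleOwners ρ D b i)
        omega
      have h7 : Fintype.card (ι → κ) * Fintype.card κ
          ≤ Fintype.card κ * (2 * ∑ D, F b D) := by
        calc _ = ∑ _D : ι → κ, Fintype.card κ := by simp
          _ ≤ ∑ D : ι → κ, 2 * ∑ j, F b (Function.update D i j) :=
            Finset.sum_le_sum fun D _ => h2 D
          _ = _ := by rw [← Finset.mul_sum, h1, smul_eq_mul]; ring
      rw [mul_comm] at h7
      exact Nat.le_of_mul_le_mul_left h7 Fintype.card_pos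
    have hbits : 2 * ((Finset.univ : Finset (ι → Bool)).filter fun b => b i = false).card
        = Fintype.card (ι → Bool) := by
      have h := sum_sum_update (κ := Bool) i (fun b : ι → Bool => if b i = false then 1 else 0)
      simp only [Function.update_self, Fintype.sum_bool] at h
      rw [← Finset.card_filter] at h
      simpa using h.symm
    rw [Finset.card_filter, Fintype.sum_prod_type, Finset.sum_comm]
    calc N = Fintype.card (ι → Bool) * Fintype.card (ι → κ) := by
          rw [hN, Fintype.card_prod, mul_comm]
      _ = 2 * ∑ b : ι → Bool with b i = false, Fintype.card (ι → κ) := by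
          rw [Finset.sum_const, smul_eq_mul, ← hbits]; ring
      _ ≤ 2 * ∑ b : ι → Bool with b i = false, 2 * ∑ D, F b D := by
          refine Nat.mul_le_mul_left _ (Finset.sum_le_sum fun b hb => ?_)
          exact hhalf b (Finset.mem_filter.1 hb).2
      _ = 4 * ∑ b : ι → Bool with b i = false, ∑ D, F b D := by
          rw [← Finset.mul_sum]; ring
      _ ≤ 4 * ∑ b : ι → Bool, ∑ D, F b D :=
          Nat.mul_le_mul_left _ (Finset.sum_le_sum_of_subset (Finset.filter_subset _ _))
  have lower : Fintype.card ι * N ≤ 4 * ∑ x : (ι → κ) × (ι → Bool), (U x.1 x.2).card := by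
    have h1 : ∑ x : (ι → κ) × (ι → Bool), (U x.1 x.2).card
        = ∑ i, ((Finset.univ : Finset ((ι → κ) × (ι → Bool))).filter
          fun x => i ∈ U x.1 x.2).card := by
      simp_rw [Finset.card_filter]
      rw [Finset.sum_comm]
      refine Finset.sum_congr rfl fun x _ => ?_
      rw [← Finset.card_filter]
      congr 1
      ext i
      simp
    rw [h1, Finset.mul_sum]
    calc Fintype.card ι * N = ∑ _i : ι, N := by simp
      _ ≤ _ := Finset.sum_le_sum fun i _ => lower_one i
  have hj := two_rpow_mul_card_le_sum (Finset.univ : Finset ((ι → κ) × (ι → Bool)))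
    (fun x => (U x.1 x.2).card) ((Fintype.card ι : ℝ) / 4) (by
      have : (Fintype.card ι : ℝ) * N
          ≤ 4 * ∑ x : (ι → κ) × (ι → Bool), ((U x.1 x.2).card : ℝ) := by exact_mod_cast lower
      rw [Finset.card_univ, ← hN]
      linarith)
  have hup : ∑ x : (ι → κ) × (ι → Bool), (2 : ℝ) ^ (U x.1 x.2).card
      ≤ (Fintype.card τ : ℝ) * N := by exact_mod_cast upper
  rw [Finset.card_univ, ← hN] at hj
  have h2 : (2 : ℝ) ^ ((Fintype.card ι : ℝ) / 4) ≤ Fintype.card τ :=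
    le_of_mul_le_mul_right (hj.trans hup) (by exact_mod_cast hNpos)
  have h3 := pow_le_pow_left₀ (Real.rpow_nonneg two_pos.le _) h2 4
  rw [← Real.rpow_natCast, ← Real.rpow_mul two_pos.le] at h3
  have h4 : (Fintype.card ι : ℝ) / 4 * ((4 : ℕ) : ℝ) = (Fintype.card ι : ℕ) := by
    push_cast; ring
  rw [h4, Real.rpow_natCast] at h3
  exact_mod_cast h3

/-! ### Block streams and cut-and-paste -/

/-- The stream which consists of `pre` and then the blocks `X 0, …, X (k - 1)`. -/
def blockStream {n : ℕ} (pre : List (Fin n)) (X : ℕ → List (Fin n)) (k : ℕ) : List (Fin n) :=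
  pre ++ (List.range k).flatMap X

theorem blockStream_succ {n : ℕ} (pre : List (Fin n)) (X : ℕ → List (Fin n)) (k : ℕ) :
    blockStream pre X (k + 1) = blockStream pre X k ++ X k := by
  simp [blockStream, List.range_succ]

namespace StreamAlg

variable {n S : ℕ} (A : StreamAlg n S) (pre : List (Fin n))

/-- The memory during pass `t` over `blockStream pre X k`, after the first `j` blocks. -/
def blockState (k : ℕ) (X : ℕ → List (Fin n)) (t j : ℕ) : Fin S → Bool :=
  (blockStream pre X j).foldl (A.step t) (A.startPass t (A.memory (blockStream pre X k) t))

theorem blockState_self (k : ℕ) (X : ℕ → List (Fin n)) (t : ℕ) :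
    A.blockState pre k X t k = A.memory (blockStream pre X k) (t + 1) := rfl

theorem blockState_succ (k : ℕ) (X : ℕ → List (Fin n)) (t j : ℕ) :
    A.blockState pre k X t (j + 1) = (X j).foldl (A.step t) (A.blockState pre k X t j) := by
  simp [blockState, blockStream_succ]

/-- The memory contents after each block in each of `r` passes. -/
def transcript (k r : ℕ) (X : ℕ → List (Fin n)) : Fin r → Fin k → Fin S → Bool :=
  fun t j => A.blockState pre k X t (j + 1)

variable {A pre}

theorem memory_eq_of_transcript_eq {k r : ℕ} (hk : 0 < k) {X Y : ℕ → List (Fin n)}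
    (h : A.transcript pre k r X = A.transcript pre k r Y) {t : ℕ} (ht : t ≤ r) :
    A.memory (blockStream pre X k) t = A.memory (blockStream pre Y k) t := by
  cases t with
  | zero => rfl
  | succ t =>
    -- The entry after the last block is the memory at the end of the pass.
    have := congrFun (congrFun h ⟨t, ht⟩) ⟨k - 1, by omega⟩
    simp only [transcript, Nat.sub_add_cancel hk] at this
    exact this

theorem blockState_eq_of_transcript_eq {k r : ℕ} (hk : 0 < k) {X Y : ℕ → List (Fin n)}
    (h : A.transcript pre k r X = A.transcript pre k r Y) {t j : ℕ} (ht : t < r) (hj : j ≤ k) :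
    A.blockState pre k X t j = A.blockState pre k Y t j := by
  cases j with
  | zero =>
    rw [blockState, blockState, memory_eq_of_transcript_eq hk h ht.le]
    rfl
  | succ j => exact congrFun (congrFun h ⟨t, ht⟩) ⟨j, hj⟩

/-- The cut-and-paste property: blocks from streams with a common transcript may be combined
without changing what the algorithm retains after each pass. -/
theorem memory_diagonal {k r : ℕ} (hk : 0 < k) {X : ℕ → List (Fin n)}
    {Z : ℕ → ℕ → List (Fin n)}
    (h : ∀ j < k, A.transcript pre k r (Z j) = A.transcript pre k r X) {t : ℕ} (ht : t ≤ r) :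
    A.memory (blockStream pre (fun j => Z j j) k) t = A.memory (blockStream pre X k) t := by
  induction t with
  | zero => rfl
  | succ t ih =>
    have ih := ih (by omega)
    rw [← blockState_self, ← blockState_self]
    -- Block `j` is read as in the stream `Z j`, whose states before and after it are those of `X`.
    have key : ∀ j ≤ k, A.blockState pre k (fun j => Z j j) t j = A.blockState pre k X t j := by
      intro j
      induction j with
      | zero => intro _; rw [blockState, blockState, ih]; rfl
      | succ j ihj =>
        intro hj
        rw [blockState_succ, ihj (by omega),
          ← blockState_eq_of_transcript_eq hk (h j hj) ht (Nat.le_of_succ_le hj),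
          ← blockState_succ, blockState_eq_of_transcript_eq hk (h j hj) ht hj]
    exact key k le_rfl

end StreamAlg

/-! ### The hard streams and their frequencies -/

open Classical in
/-- The items `i < m` owned by `j` whose bit is set. -/
noncomputable def ownedBlock {n m k : ℕ} (D : {i : Fin n // (i : ℕ) < m} → Fin k)
    (b : {i : Fin n // (i : ℕ) < m} → Bool) (j : ℕ) : List (Fin n) :=
  (Finset.univ.filter fun e : Fin n =>
    ∃ h : (e : ℕ) < m, (D ⟨e, h⟩ : ℕ) = j ∧ b ⟨e, h⟩ = true).toList

open Classical in
theorem count_ownedBlock {n m k : ℕ} (D : {i : Fin n // (i : ℕ) < m} → Fin k)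
    (b : {i : Fin n // (i : ℕ) < m} → Bool) (j : ℕ) (e : Fin n) :
    (ownedBlock D b j).count e
      = if ∃ h : (e : ℕ) < m, (D ⟨e, h⟩ : ℕ) = j ∧ b ⟨e, h⟩ = true then 1 else 0 := by
  rw [ownedBlock, List.Nodup.count (Finset.nodup_toList _)]
  simp

/-- Four copies of every item `i ≥ m`. -/
noncomputable def dummyItems (n m : ℕ) : List (Fin n) :=
  (Finset.univ.filter fun e : Fin n => m ≤ (e : ℕ)).toList.flatMap (List.replicate 4)

theorem count_dummyItems (n m : ℕ) (e : Fin n) :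
    (dummyItems n m).count e = if m ≤ (e : ℕ) then 4 else 0 := by
  rw [dummyItems, List.count_flatMap, Finset.sum_map_toList]
  simp only [Function.comp_apply, List.count_replicate, beq_iff_eq, Finset.sum_ite_eq',
    Finset.mem_filter, Finset.mem_univ, true_and]

theorem count_blockStream {n : ℕ} (pre : List (Fin n)) (X : ℕ → List (Fin n)) (k : ℕ) (e : Fin n) :
    (blockStream pre X k).count e = pre.count e + ∑ j ∈ Finset.range k, (X j).count e := by
  induction k with
  | zero => simp [blockStream]
  | succ k ih => rw [blockStream_succ, List.count_append, ih, Finset.sum_range_succ, add_assoc]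

theorem length_eq_sum_count {n : ℕ} (w : List (Fin n)) : w.length = ∑ e, w.count e := by
  simpa using (Multiset.sum_count_eq_card (s := Finset.univ) (m := (w : Multiset (Fin n)))
    (by simp)).symm

section Frequencies

variable {n m k : ℕ} {D : {i : Fin n // (i : ℕ) < m} → Fin k}
  {D' : ℕ → {i : Fin n // (i : ℕ) < m} → Fin k} {b' : ℕ → {i : Fin n // (i : ℕ) < m} → Bool}

theorem streamFreq_dummy {e : Fin n} (he : m ≤ (e : ℕ)) :
    streamFreq (blockStream (dummyItems n m) (fun j => ownedBlock (D' j) (b' j) j) k) e = 4 := by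
  have : ¬ (e : ℕ) < m := by omega
  simp [streamFreq, count_blockStream, count_dummyItems, count_ownedBlock, he, this]

theorem streamFreq_real (i : {i : Fin n // (i : ℕ) < m}) :
    streamFreq (blockStream (dummyItems n m) (fun j => ownedBlock (D' j) (b' j) j) k) i
      = ((Finset.range k).filter fun j => (D' j i : ℕ) = j ∧ b' j i = true).card := by
  have h1 : ¬ m ≤ ((i : Fin n) : ℕ) := not_le.2 i.2
  rw [Finset.card_filter]
  simp [streamFreq, count_blockStream, count_dummyItems, count_ownedBlock, h1, i.2]

theorem streamFreq_real_le (i : {i : Fin n // (i : ℕ) < m}) :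
    streamFreq (blockStream (dummyItems n m) (fun j => ownedBlock (D' j) (b' j) j) k) i ≤ k := by
  rw [streamFreq_real]
  exact (Finset.card_filter_le _ _).trans (by simp)

/-- Even in a spliced stream, only the block of the common owner can contain `i`. -/
theorem streamFreq_real_le_one {i : {i : Fin n // (i : ℕ) < m}} (h : ∀ j < k, D' j i = D i) :
    streamFreq (blockStream (dummyItems n m) (fun j => ownedBlock (D' j) (b' j) j) k) i ≤ 1 := by
  rw [streamFreq_real, Finset.card_le_one]
  intro a ha c hc
  simp only [Finset.mem_filter, Finset.mem_range] at ha hc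
  rw [← ha.2.1, ← hc.2.1, h a ha.1, h c hc.1]

end Frequencies

/-! ### Light and heavy thresholds -/

/-- The at least `n / 2` dummies contribute `4 ^ p ≥ 4` each, so the lower threshold is at least `ε
^ p * n ≥ 1`. -/
theorem not_mem_of_le_one_of_dummies {n : ℕ} {p ε : ℝ} (hp : 1 ≤ p) (hε : 1 ≤ ε ^ p * n)
    {x : Fin n → ℕ} (hx : ∀ e : Fin n, n / 2 ≤ (e : ℕ) → x e = 4) {T : Finset (Fin n)}
    (hT : IsHeavyHitterSet p ε x T) {i : Fin n} (hi : x i ≤ 1) : i ∉ T := by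
  refine (hT i).2 ?_
  have hp0 : 0 ≤ p := by linarith
  have h1 : (x i : ℝ) ^ p ≤ 1 := Real.rpow_le_one (by positivity) (by exact_mod_cast hi) hp0
  have hεp : 0 < ε ^ p := by
    by_contra h
    have : ε ^ p * n ≤ 0 := mul_nonpos_of_nonpos_of_nonneg (not_lt.1 h) (by positivity)
    linarith
  have hcard : (n : ℝ) ≤ 2 * ((Finset.univ : Finset (Fin n)).filter
      fun e : Fin n => n / 2 ≤ (e : ℕ)).card := by
    have h2 : ((Finset.univ : Finset (Fin n)).filter
        fun e : Fin n => (e : ℕ) < n / 2).card ≤ n / 2 := by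
      have h4 := Finset.card_le_card_of_injOn (fun e : Fin n => (e : ℕ))
        (s := (Finset.univ : Finset (Fin n)).filter fun e : Fin n => (e : ℕ) < n / 2)
        (t := Finset.range (n / 2)) (by intro e he; simpa using he)
        (fun a _ b _ h => Fin.ext h)
      simpa using h4
    have h3 := Finset.card_filter_add_card_filter_not (s := (Finset.univ : Finset (Fin n)))
      (fun e : Fin n => (e : ℕ) < n / 2)
    simp only [not_lt, Finset.card_univ, Fintype.card_fin] at h3
    have : n ≤ 2 * ((Finset.univ : Finset (Fin n)).filter
        fun e : Fin n => n / 2 ≤ (e : ℕ)).card := by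
      omega
    exact_mod_cast this
  have hsum : 2 * (n : ℝ) ≤ ∑ j, (x j : ℝ) ^ p := by
    calc 2 * (n : ℝ) ≤ ∑ e ∈ (Finset.univ : Finset (Fin n)).filter
          fun e : Fin n => n / 2 ≤ (e : ℕ), (4 : ℝ) := by
          rw [Finset.sum_const, nsmul_eq_mul]; linarith
      _ ≤ ∑ e ∈ (Finset.univ : Finset (Fin n)).filter
          fun e : Fin n => n / 2 ≤ (e : ℕ), (x e : ℝ) ^ p := by
          refine Finset.sum_le_sum fun e he => ?_
          rw [hx e (Finset.mem_filter.1 he).2]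
          exact_mod_cast Real.self_le_rpow_of_one_le (by norm_num : (1 : ℝ) ≤ 4) hp
      _ ≤ _ := Finset.sum_le_sum_of_subset_of_nonneg (Finset.filter_subset _ _)
          fun _ _ _ => by positivity
  calc (x i : ℝ) ^ p ≤ ε ^ p / 2 * (2 * n) := by linarith
    _ ≤ _ := by gcongr

/-- As `ε ^ p ≤ 1 / 2`, the item's own share of the threshold is at most half of `x i ^ p`; as `2 *
4 ^ p ≤ 8 ^ p`, so is the share of all the others. -/
theorem mem_of_le_of_forall_le_four {n : ℕ} {p ε : ℝ} (hp : 1 ≤ p) (hε : 0 < ε) (hε' : ε < 1 / 2)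
    {x : Fin n → ℕ} {i : Fin n} (hx : ∀ e, e ≠ i → x e ≤ 4) {T : Finset (Fin n)}
    (hT : IsHeavyHitterSet p ε x T) (hi : 8 * (ε * (n : ℝ) ^ (1 / p)) ≤ x i) : i ∈ T := by
  refine (hT i).1 ?_
  have hp0 : 0 < p := by linarith
  have hεp : ε ^ p ≤ 1 / 2 :=
    (Real.rpow_le_self_of_le_one hε.le (by linarith) hp).trans hε'.le
  have hsum : ∑ j, (x j : ℝ) ^ p ≤ (x i : ℝ) ^ p + n * 4 ^ p := by
    rw [← Finset.add_sum_erase _ _ (Finset.mem_univ i)]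
    refine add_le_add_right ?_ _
    calc ∑ j ∈ Finset.univ.erase i, (x j : ℝ) ^ p ≤ ∑ j ∈ Finset.univ.erase i, (4 : ℝ) ^ p := by
          refine Finset.sum_le_sum fun e he => Real.rpow_le_rpow (by positivity) ?_ hp0.le
          exact_mod_cast hx e (Finset.ne_of_mem_erase he)
      _ ≤ ∑ _j : Fin n, (4 : ℝ) ^ p :=
          Finset.sum_le_sum_of_subset_of_nonneg (Finset.erase_subset _ _) fun _ _ _ => by positivity
      _ = n * 4 ^ p := by simp
  have h1 := Real.rpow_le_rpow (by positivity) hi hp0.le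
  rw [Real.mul_rpow (by norm_num) (by positivity), Real.mul_rpow hε.le (by positivity),
    ← Real.rpow_mul (by positivity), one_div_mul_cancel hp0.ne', Real.rpow_one] at h1
  have h2 : 2 * (4 : ℝ) ^ p ≤ 8 ^ p := by
    rw [show (8 : ℝ) = 2 * 4 by norm_num, Real.mul_rpow (by norm_num) (by norm_num)]
    gcongr
    exact Real.self_le_rpow_of_one_le one_le_two hp
  have h3 : 0 ≤ ε ^ p * n := by positivity
  have h4 : 0 ≤ (x i : ℝ) ^ p := by positivity
  calc ε ^ p * ∑ j, (x j : ℝ) ^ p ≤ ε ^ p * ((x i : ℝ) ^ p + n * 4 ^ p) := by gcongr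
    _ = ε ^ p * (x i : ℝ) ^ p + (4 : ℝ) ^ p * (ε ^ p * n) := by ring
    _ ≤ (x i : ℝ) ^ p := by nlinarith

/-! ### The space bound -/

theorem ownedBlock_update_of_false {n m k : ℕ} (D : {i : Fin n // (i : ℕ) < m} → Fin k)
    (b : {i : Fin n // (i : ℕ) < m} → Bool) (i : {i : Fin n // (i : ℕ) < m}) (l : Fin k)
    (hb : b i = false) : ownedBlock (Function.update D i l) b = ownedBlock D b := by
  funext j
  unfold ownedBlock
  congr 1
  ext e
  simp only [Finset.mem_filter, Finset.mem_univ, true_and]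
  refine exists_congr fun h => ?_
  by_cases hi : (⟨e, h⟩ : {i : Fin n // (i : ℕ) < m}) = i
  · simp [hi, hb]
  · rw [Function.update_of_ne hi]

/-- Two streams with the same final memory receive the same answer, but an item can be heavy in
the second and not in the first, so not many owners are compatible with one transcript. -/
theorem StreamAlg.card_compatibleOwners_le {n S k r L : ℕ} {p ε : ℝ} {A : StreamAlg n S}
    (hp : 1 ≤ p) (hε : 0 < ε) (hε' : ε < 1 / 2) (hεn : 1 ≤ ε ^ p * n) (hk0 : 0 < k)
    (hk : 16 * (ε * (n : ℝ) ^ (1 / p)) ≤ k) (hL : 4 * n + k ≤ L)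
    (hA : A.SolvesHeavyHitters r p ε L)
    (D : {i : Fin n // (i : ℕ) < n / 2} → Fin k) (b : {i : Fin n // (i : ℕ) < n / 2} → Bool)
    (i : {i : Fin n // (i : ℕ) < n / 2}) :
    2 * (compatibleOwners
      (fun D b => A.transcript (dummyItems n (n / 2)) k r (ownedBlock D b)) D b i).card ≤ k := by
  classical
  set ρ := fun (D : {i : Fin n // (i : ℕ) < n / 2} → Fin k) b =>
    A.transcript (dummyItems n (n / 2)) k r (ownedBlock D b) with hρ
  set V := compatibleOwners ρ D b i with hV
  by_contra! hcon
  -- For compatible `j`, a stream with the given transcript whose block `j` contains `i`; for other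
  -- `j`, the original stream.
  have hex : ∀ j : ℕ, ∃ Db : ({i : Fin n // (i : ℕ) < n / 2} → Fin k) ×
      ({i : Fin n // (i : ℕ) < n / 2} → Bool), ρ Db.1 Db.2 = ρ D b ∧ (∀ e, e ≠ i → Db.1 e = D e) ∧
      ∀ h : j < k, ⟨j, h⟩ ∈ V → Db.1 i = ⟨j, h⟩ ∧ Db.2 i = true := by
    intro j
    by_cases h : ∃ h : j < k, ⟨j, h⟩ ∈ V
    · obtain ⟨hj, hjV⟩ := h
      obtain ⟨b', hb', hb''⟩ := mem_compatibleOwners.1 hjV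
      exact ⟨(Function.update D i ⟨j, hj⟩, b'), hb'',
        fun e he => Function.update_of_ne he _ _, fun _ _ => ⟨Function.update_self .., hb'⟩⟩
    · exact ⟨(D, b), rfl, fun _ _ => rfl, fun h1 h2 => absurd ⟨h1, h2⟩ h⟩
  choose Z hZρ hZD hZV using hex
  -- Covers both the original stream and the spliced one.
  have valid : ∀ {D' : ℕ → {i : Fin n // (i : ℕ) < n / 2} → Fin k}
      {b' : ℕ → {i : Fin n // (i : ℕ) < n / 2} → Bool},
      (∀ j, ∀ e ≠ i, D' j e = D e) →
      (∀ e, e ≠ (i : Fin n) → streamFreq (blockStream (dummyItems n (n / 2))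
        (fun j => ownedBlock (D' j) (b' j) j) k) e ≤ 4) ∧
      IsHeavyHitterSet p ε (streamFreq (blockStream (dummyItems n (n / 2))
        (fun j => ownedBlock (D' j) (b' j) j) k)) (A.output (A.memory (blockStream
          (dummyItems n (n / 2)) (fun j => ownedBlock (D' j) (b' j) j) k) r)) := by
    intro D' b' hD'
    have hfour : ∀ e, e ≠ (i : Fin n) → streamFreq (blockStream (dummyItems n (n / 2))
        (fun j => ownedBlock (D' j) (b' j) j) k) e ≤ 4 := by
      intro e he
      by_cases hm : (e : ℕ) < n / 2
      · refine (streamFreq_real_le_one (D := D) (i := ⟨e, hm⟩) fun j _ => hD' j _ ?_).trans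
          (by norm_num)
        rintro rfl
        exact he rfl
      · exact (streamFreq_dummy (not_lt.1 hm)).le
    refine ⟨hfour, hA _ ?_ ?_⟩
    · intro h0
      have hlast : n / 2 ≤ n - 1 := by have := i.2; omega
      have hn : n - 1 < n := by have := i.2; omega
      have := streamFreq_dummy (k := k) (D' := D') (b' := b') (e := (⟨n - 1, hn⟩ : Fin n)) hlast
      rw [h0] at this
      simp [streamFreq] at this
    · rw [length_eq_sum_count, ← Finset.add_sum_erase _ _ (Finset.mem_univ (i : Fin n))]
      have h1 := streamFreq_real_le (k := k) (D' := D') (b' := b') i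
      have h2 := Finset.sum_le_card_nsmul (Finset.univ.erase (i : Fin n)) _ 4
        fun e he => hfour e (Finset.ne_of_mem_erase he)
      have h3 := Finset.card_erase_le (s := (Finset.univ : Finset (Fin n))) (a := (i : Fin n))
      rw [Finset.card_univ, Fintype.card_fin] at h3
      rw [smul_eq_mul] at h2
      unfold streamFreq at h1 h2
      omega
  have hlight := (valid (D' := fun _ => D) (b' := fun _ => b) fun _ _ _ => rfl).2
  have hheavy := valid (D' := fun j => (Z j).1) (b' := fun j => (Z j).2) hZD
  have hmem := A.memory_diagonal (pre := dummyItems n (n / 2)) (r := r) hk0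
    (X := ownedBlock D b) (Z := fun j => ownedBlock (Z j).1 (Z j).2) (fun j _ => hZρ j) le_rfl
  refine not_mem_of_le_one_of_dummies hp hεn (fun e he => streamFreq_dummy he) hlight
    (streamFreq_real_le_one (D := D) (i := i) fun _ _ => rfl) ?_
  have key := mem_of_le_of_forall_le_four hp hε hε' hheavy.1 hheavy.2 ?_
  · rwa [hmem] at key
  · rw [streamFreq_real]
    have hle : V.card ≤ ((Finset.range k).filter
        fun j => ((Z j).1 i : ℕ) = j ∧ (Z j).2 i = true).card := by
      refine Finset.card_le_card_of_injOn (fun j : Fin k => (j : ℕ)) ?_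
        (fun a _ c _ h => Fin.ext h)
      intro j hj
      have := hZV j j.2 hj
      simp [this.1, this.2]
    have : (k : ℝ) < 2 * V.card := by exact_mod_cast hcon
    have : (V.card : ℝ) ≤ _ := Nat.cast_le.2 hle
    linarith

theorem StreamAlg.half_le_of_solvesHeavyHitters {n S k r L : ℕ} {p ε : ℝ} {A : StreamAlg n S}
    (hp : 1 ≤ p) (hε : 0 < ε) (hε' : ε < 1 / 2) (hεn : 1 ≤ ε ^ p * n) (hk0 : 0 < k)
    (hk : 16 * (ε * (n : ℝ) ^ (1 / p)) ≤ k) (hL : 4 * n + k ≤ L)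
    (hA : A.SolvesHeavyHitters r p ε L) : n / 2 ≤ 4 * (S * k * r) := by
  have : Nonempty (Fin k) := ⟨⟨0, hk0⟩⟩
  have h := two_pow_card_le_card_transcripts_pow
    (fun (D : {i : Fin n // (i : ℕ) < n / 2} → Fin k) b =>
      A.transcript (dummyItems n (n / 2)) k r (ownedBlock D b))
    (fun D b i j hb => by rw [ownedBlock_update_of_false D b i j hb])
    (fun D b i => by
      rw [Fintype.card_fin]
      exact A.card_compatibleOwners_le hp hε hε' hεn hk0 hk hL hA D b i)
  have hcard : Fintype.card {i : Fin n // (i : ℕ) < n / 2} = n / 2 := by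
    rw [Fintype.card_congr (Fin.castLEquiv (Nat.div_le_self n 2)).symm]
    simp
  simp only [hcard, Fintype.card_fun, Fintype.card_bool, Fintype.card_fin, ← pow_mul] at h
  have := (Nat.pow_le_pow_iff_right one_lt_two).1 h
  linarith

theorem StreamAlg.space_lower_bound {n S r : ℕ} {p ε : ℝ} {A : StreamAlg n S}
    (hn : 1 ≤ n) (hp : 1 ≤ p) (hε : 1 / (n : ℝ) ^ (1 / p) < ε) (hε' : ε < 1 / 2) (hr : 1 ≤ r)
    (hA : A.SolvesHeavyHitters r p ε (13 * n)) :
    1 / 204 * ((n : ℝ) ^ (1 - 1 / p) / (r * ε)) ≤ S := by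
  have hn0 : (0 : ℝ) < n := by exact_mod_cast hn
  have hp0 : 0 < p := by linarith
  set q := (n : ℝ) ^ (1 / p) with hq
  have hq0 : 0 < q := Real.rpow_pos_of_pos hn0 _
  have hε0 : 0 < ε := lt_trans (by positivity) hε
  have hεq : 1 < ε * q := by rwa [div_lt_iff₀ hq0] at hε
  have hqn : q ≤ n := by
    rw [hq]
    nth_rewrite 2 [← Real.rpow_one (n : ℝ)]
    exact Real.rpow_le_rpow_of_exponent_le (by exact_mod_cast hn) ((div_le_one hp0).2 hp)
  have hqp : q ^ p = n := by
    rw [hq, ← Real.rpow_mul hn0.le, one_div_mul_cancel hp0.ne', Real.rpow_one]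
  have hεn : 1 ≤ ε ^ p * n := by
    rw [← hqp, ← Real.mul_rpow hε0.le hq0.le]
    exact Real.one_le_rpow hεq.le hp0.le
  -- More than `k / 2` copies then exceed the heavy threshold `8 * (ε * q)`.
  set k := ⌈16 * (ε * q)⌉₊ with hk
  have hk1 : 16 * (ε * q) ≤ k := Nat.le_ceil _
  have hk2 : (k : ℝ) < 16 * (ε * q) + 1 := Nat.ceil_lt_add_one (by positivity)
  have hk0 : 0 < k := Nat.ceil_pos.2 (by positivity)
  have hεqn : ε * q ≤ 1 / 2 * n := by gcongr
  have hL : 4 * n + k ≤ 13 * n := by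
    have : (4 * n + k : ℝ) ≤ 13 * n := by linarith
    exact_mod_cast this
  have h := A.half_le_of_solvesHeavyHitters hp hε0 hε' hεn hk0 hk1 hL hA
  -- Needed for `n ≤ 3 * (n / 2)` with floor division.
  have hn2 : 2 ≤ n := by
    have : (2 : ℝ) < n := by linarith
    exact_mod_cast this.le
  have h' : n ≤ 3 * (4 * (S * k * r)) := by omega
  have h'' : (n : ℝ) ≤ 3 * (4 * (S * k * r)) := by exact_mod_cast h'
  have hr0 : (0 : ℝ) < r := by exact_mod_cast hr
  have hsplit : (n : ℝ) ^ (1 - 1 / p) = n / q := by rw [Real.rpow_sub hn0, Real.rpow_one]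
  rw [hsplit, div_div, one_div_mul_eq_div, div_div, div_le_iff₀ (by positivity)]
  calc (n : ℝ) ≤ 3 * (4 * (S * k * r)) := h''
    -- The ceiling costs at most `1 < ε * q`; and `204 = 3 * 4 * 17`.
    _ ≤ 3 * (4 * (S * (17 * (ε * q)) * r)) := by gcongr; linarith
    _ = _ := by ring

theorem mainTheorem4 :
    ∃ (c : ℝ) (K : ℕ), 0 < c ∧
      (∀ (n : ℕ) (p ε : ℝ) (r S : ℕ) (A : StreamAlg n S),
        1 ≤ n → 1 ≤ p → 1 / (n : ℝ) ^ (1 / p) < ε → ε < 1 / 2 → 1 ≤ r →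
        A.SolvesHeavyHitters r p ε (K * n) →
        c * ((n : ℝ) ^ (1 - 1 / p) / (r * ε)) ≤ (S : ℝ)) ∧
      (∀ R : ℕ, ∃ c' : ℝ, 0 < c' ∧
        ∀ (n : ℕ) (ε : ℝ) (r S : ℕ) (A : StreamAlg n S),
          1 ≤ n → 1 / (n : ℝ) ^ (1 / 2 : ℝ) < ε → ε < 1 / 2 → 1 ≤ r → r ≤ R →
          A.SolvesHeavyHitters r 2 ε (K * n) →
          c' * (Real.sqrt n / ε) ≤ (S : ℝ)) := by
  refine ⟨1 / 204, 13, by norm_num,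
    fun n p ε r S A hn hp hε hε' hr hA => A.space_lower_bound hn hp hε hε' hr hA,
    -- `R + 1` keeps the constant positive at `R = 0`.
    fun R => ⟨1 / 204 / (R + 1), by positivity, fun n ε r S A hn hε hε' hr hrR hA => ?_⟩⟩
  refine le_trans ?_ (A.space_lower_bound hn one_le_two hε hε' hr hA)
  have hn0 : (0 : ℝ) < n := by exact_mod_cast hn
  have hε0 : 0 < ε := lt_trans (by positivity) hε
  have hr0 : (0 : ℝ) < r := by exact_mod_cast hr
  have hrR' : (r : ℝ) ≤ R + 1 := by
    have : (r : ℝ) ≤ R := by exact_mod_cast hrR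
    linarith
  rw [show (1 - 1 / 2 : ℝ) = 1 / 2 by norm_num, ← Real.sqrt_eq_rpow]
  calc 1 / 204 / ((R : ℝ) + 1) * (√n / ε) = 1 / 204 * (√n / ((R + 1) * ε)) := by
        field_simp
    _ ≤ 1 / 204 * (√n / (r * ε)) := by gcongr
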